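/- For elements $g,h$ of a group $G$ write $g\sim_{\pm}h$ if $g$ is conjugate to $h$ or to $h^{-1}$, and let $[g]_{\pm}$ be the class of $g$ under this equivalence relation. The elements $g,h$ form a \emph{Magnus pair} if $[g]_{\pm}\neq[h]_{\pm}$ and the normal closures of $g$ and of $h$ in $G$ coincide. Let $\mathbb{U}$ be the following space, the total space of a graph of spaces with four vertices and eight edges. The vertex spaces are two oriented circles, labelled $u$ and $v$, and two spheres with four open discs removed, $\Sigma_u$ and $\Sigma_v$, each with an orientation. The edge spaces are circles, one for each boundary circle of $\Sigma_u$ and of $\Sigma_v$: for each boundary circle, a cylinder $[0,1]\times S^1$ is attached by a homeomorphism at one end to that boundary circle and at the other end to one of the two vertex circles. One boundary circle of $\Sigma_u$ is attached in this way to $u$ and the other three to $v$; one boundary circle of $\Sigma_v$ is attached to $v$ and the other three to $u$. All attaching maps are homeomorphisms onto these circles (degree $\pm1$), and the orientations are as follows: for each of the two surfaces, the identification with the oriented vertex circle agrees with the boundary orientation of the surface on the boundary circle that goes to the circle with the surface's own label and on two of the other three boundary circles, and it is opposite to the boundary orientation on the remaining one. Let $x\in\mathbb{U}$, let $\gamma_u$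 and $\gamma_v$ be paths in $\mathbb{U}$ from $x$ to the base points of the vertex circles $u$ and $v$, and let $u,v\in\pi_1(\mathbb{U},x)$ also denote the classes of the loops that follow $\gamma_u$ (respectively $\gamma_v$), run once around the circle $u$ (respectively $v$) in its positive direction, and return along the same path. Then $u$ and $v$ form a Magnus pair in $\pi_1(\mathbb{U},x)$: they have the same normal closure, and $u$ is conjugate neither to $v$ nor to $v^{-1}$. -/

import Mathlib

noncomputable section

namespace MagnusPair

/-! ## Magnus pairs in a group -/

/-- `g ∼± h` iff `g` is conjugate to `h` or to `h⁻¹`. -/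
def pmConj (G : Type*) [Group G] : Setoid G where
  r g h := IsConj g h ∨ IsConj g h⁻¹
  iseqv := by
    have inv : ∀ {a b : G}, IsConj a b → IsConj a⁻¹ b⁻¹ := by
      intro a b h
      obtain ⟨c, hc⟩ := isConj_iff.1 h
      exact isConj_iff.2 ⟨c, by rw [← hc]; group⟩
    refine ⟨fun g => Or.inl (IsConj.refl g), ?_, ?_⟩
    · rintro a b (h | h)
      · exact Or.inl h.symm
      · exact Or.inr (by simpa using (inv h).symm)
    · rintro a b c (h | h) (k | k)
      · exact Or.inl (h.trans k)
      · exact Or.inr (h.trans k)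
      · exact Or.inr (h.trans (inv k))
      · exact Or.inl (h.trans (by simpa using inv k))

/-- The class `[g]±` of `g` under `∼±`. -/
def pmClass {G : Type*} [Group G] (g : G) : Quotient (pmConj G) := Quotient.mk (pmConj G) g

/-- `g` and `h` are a Magnus pair: `[g]± ≠ [h]±`, and `g` and `h` have the same normal closure. -/
def IsMagnusPair {G : Type*} [Group G] (g h : G) : Prop :=
  pmClass g ≠ pmClass h ∧ Subgroup.normalClosure {g} = Subgroup.normalClosure {h}

/-! ## The four-holed sphere -/

/-- The sphere with four open discs removed, as the closed disc of radius `4` about `0` in the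
plane minus the open discs of radius `1/2` about `-2`, `0` and `2`. -/
def FourHoledSphere : Type :=
  {w : ℂ // ‖w‖ ≤ 4 ∧ 1 / 2 ≤ ‖w + 2‖ ∧ 1 / 2 ≤ ‖w‖ ∧ 1 / 2 ≤ ‖w - 2‖}

instance : TopologicalSpace FourHoledSphere :=
  inferInstanceAs (TopologicalSpace {w : ℂ //
    ‖w‖ ≤ 4 ∧ 1 / 2 ≤ ‖w + 2‖ ∧ 1 / 2 ≤ ‖w‖ ∧ 1 / 2 ≤ ‖w - 2‖})

/-- Parametrizations of the four boundary circles: number `0` is the outer circle, numbers `1`, `2`,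
`3` are the circles about `-2`, `0`, `2`. Circles `0`, `1`, `2` carry the boundary orientation
(outer circle counterclockwise, inner circles clockwise), circle `3` the opposite one. -/
def boundaryPoint : Fin 4 → Circle → ℂ
  | 0, z => 4 * (z : ℂ)
  | 1, z => -2 + (starRingEnd ℂ (z : ℂ)) / 2
  | 2, z => (starRingEnd ℂ (z : ℂ)) / 2
  | 3, z => 2 + (z : ℂ) / 2

theorem boundaryPoint_mem (i : Fin 4) (z : Circle) :
    ‖boundaryPoint i z‖ ≤ 4 ∧ 1 / 2 ≤ ‖boundaryPoint i z + 2‖ ∧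
      1 / 2 ≤ ‖boundaryPoint i z‖ ∧ 1 / 2 ≤ ‖boundaryPoint i z - 2‖ := by
  -- a point at distance `r` from `c` has norm between `|c| - r` and `|c| + r`
  have key : ∀ (x c : ℂ) (r s : ℝ), ‖x‖ = r → ‖c‖ = s →
      ‖x + c‖ ≤ r + s ∧ s - r ≤ ‖x + c‖ ∧ r - s ≤ ‖x + c‖ := by
    intro x c r s hx hc
    have h1 := norm_add_le x c
    have h2 := norm_sub_le (x + c) x
    have h3 := norm_sub_le (x + c) c
    simp only [add_sub_cancel_left, add_sub_cancel_right] at h2 h3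
    refine ⟨?_, ?_, ?_⟩ <;> linarith
  have n0 : ‖(0 : ℂ)‖ = 0 := norm_zero
  have n2 : ‖(2 : ℂ)‖ = 2 := by norm_num
  have n2' : ‖(-2 : ℂ)‖ = 2 := by norm_num
  have n4 : ‖(4 : ℂ)‖ = 4 := by norm_num
  have n4' : ‖(-4 : ℂ)‖ = 4 := by norm_num
  have main : ∀ (x : ℂ) (r : ℝ), ‖x‖ = r → ∀ c : ℂ,
      (r = 4 ∧ c = 0 ∨ r = 1 / 2 ∧ (c = -2 ∨ c = 0 ∨ c = 2)) →
      ‖x + c‖ ≤ 4 ∧ 1 / 2 ≤ ‖x + c + 2‖ ∧ 1 / 2 ≤ ‖x + c‖ ∧ 1 / 2 ≤ ‖x + c - 2‖ := by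
    rintro x r hx c (⟨rfl, rfl⟩ | ⟨rfl, rfl | rfl | rfl⟩)
    · have a := key x 2 4 2 hx n2
      have b := key x (-2) 4 2 hx n2'
      rw [← sub_eq_add_neg] at b
      rw [add_zero, hx]
      refine ⟨?_, ?_, ?_, ?_⟩ <;> linarith
    · have a := key x (-2) (1 / 2) 2 hx n2'
      have b := key x (-4) (1 / 2) 4 hx n4'
      rw [show x + -2 + 2 = x by ring, show x + -2 - 2 = x + -4 by ring, hx]
      refine ⟨?_, ?_, ?_, ?_⟩ <;> linarith
    · have a := key x 2 (1 / 2) 2 hx n2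
      have b := key x (-2) (1 / 2) 2 hx n2'
      rw [← sub_eq_add_neg] at b
      rw [add_zero, hx]
      refine ⟨?_, ?_, ?_, ?_⟩ <;> linarith
    · have a := key x 2 (1 / 2) 2 hx n2
      have b := key x 4 (1 / 2) 4 hx n4
      rw [show x + 2 + 2 = x + 4 by ring, show x + 2 - 2 = x by ring, hx]
      refine ⟨?_, ?_, ?_, ?_⟩ <;> linarith
  have hz : ‖(z : ℂ) / 2‖ = 1 / 2 := by simp [Circle.norm_coe]
  have hz' : ‖(starRingEnd ℂ (z : ℂ)) / 2‖ = 1 / 2 := by simp [Circle.norm_coe]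
  have hz4 : ‖4 * (z : ℂ)‖ = 4 := by simp [Circle.norm_coe]
  fin_cases i
  · simpa [boundaryPoint] using main _ _ hz4 0 (by norm_num)
  · have h := main _ _ hz' (-2) (by norm_num)
    rw [add_comm _ (-2 : ℂ)] at h
    exact h
  · simpa [boundaryPoint] using main _ _ hz' 0 (by norm_num)
  · have h := main _ _ hz 2 (by norm_num)
    rw [add_comm _ (2 : ℂ)] at h
    exact h

/-- The `i`-th boundary circle of the four-holed sphere. -/
def boundaryCircle (i : Fin 4) (z : Circle) : FourHoledSphere :=
  ⟨boundaryPoint i z, boundaryPoint_mem i z⟩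

/-! ## The graph of spaces `𝕌`

Four vertex spaces: the circles labelled `u`, `v` and the four-holed spheres `Σ_u`, `Σ_v`. Eight
edge spaces, all circles: one for each boundary circle of each of the two surfaces. -/

inductive Label : Type
  | u
  | v

/-- The other label. -/
def Label.other : Label → Label
  | .u => .v
  | .v => .u

/-- The circle to which the `i`-th boundary circle of `Σ_s` is attached: the outer boundary of `Σ_s`
goes to the circle `s`, the three inner ones go to the other circle. -/
def target (s : Label) (i : Fin 4) : Label := if i = 0 then s else s.other

/-- The disjoint union of the vertex circles, the vertex surfaces, and the cylinders
`[0, 1] × S¹` over the edges. -/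
abbrev Pieces : Type :=
  ((Σ _ : Label, Circle) ⊕ (Σ _ : Label, FourHoledSphere)) ⊕
    (Σ _ : Label × Fin 4, unitInterval × Circle)

/-- The point `z` of the vertex circle labelled `s`. -/
def Pieces.circ (s : Label) (z : Circle) : Pieces := Sum.inl (Sum.inl ⟨s, z⟩)

/-- The point `p` of the vertex surface `Σ_s`. -/
def Pieces.surf (s : Label) (p : FourHoledSphere) : Pieces := Sum.inl (Sum.inr ⟨s, p⟩)

/-- The point `(t, z)` of the cylinder over the edge for the `i`-th boundary circle of `Σ_s`. -/
def Pieces.cyl (s : Label) (i : Fin 4) (t : unitInterval) (z : Circle) : Pieces :=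
  Sum.inr ⟨(s, i), (t, z)⟩

/-- The gluing: each cylinder is attached at `0` to a boundary circle of a surface and at `1` to
a vertex circle, both attaching maps having degree one for the chosen parametrizations. -/
inductive Glue : Pieces → Pieces → Prop
  | surf (s : Label) (i : Fin 4) (z : Circle) :
      Glue (Pieces.cyl s i 0 z) (Pieces.surf s (boundaryCircle i z))
  | circ (s : Label) (i : Fin 4) (z : Circle) :
      Glue (Pieces.cyl s i 1 z) (Pieces.circ (target s i) z)

/-- The total space of the graph of spaces, with the quotient topology. -/
def U : Type := Quot Glue

instance : TopologicalSpace U := inferInstanceAs (TopologicalSpace (Quot Glue))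

/-- The inclusion of the vertex circle labelled `s` in `𝕌`. -/
def circlePoint (s : Label) (z : Circle) : U := Quot.mk Glue (Pieces.circ s z)

theorem continuous_circlePoint (s : Label) : Continuous (circlePoint s) :=
  continuous_quot_mk.comp (continuous_inl.comp (continuous_inl.comp continuous_sigmaMk))

/-- The loop in `𝕌` that runs once around the vertex circle labelled `s`. -/
def circleLoop (s : Label) : Path (circlePoint s 1) (circlePoint s 1) where
  toFun t := circlePoint s (Circle.exp (2 * Real.pi * (t : ℝ)))
  continuous_toFun := (continuous_circlePoint s).comp (by fun_prop)
  source' := by simp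
  target' := by simp

/-- The element of `π₁(𝕌, x)` given by the loop labelled `s` and a path `γ` from `x` to that loop. -/
def loopElement (s : Label) {x : U} (γ : Path x (circlePoint s 1)) : FundamentalGroup U x :=
  FundamentalGroup.fromPath
    (Path.Homotopic.Quotient.mk ((γ.trans (circleLoop s)).trans γ.symm))

end MagnusPair

end

noncomputable section

namespace MagnusPair

open scoped Quaternion unitInterval
open Topology CategoryTheory

/-! ## The target space: the quotient of `ℍˣ` by a binary dihedral group -/

/-! Non-conjugacy. Put `ζ = exp (π i / 4)`. The aim is to send `v` to `ζ` and `u` to `ζ ^ 3`, up to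
conjugacy, in the binary dihedral group of order 16 generated by `ζ` and `j`. Conjugation by `j`
inverts `ζ`, so a suitable choice of conjugates makes the three inner boundary circles of a surface
contribute equal powers of `ζ` despite their different orientations. The outer circle must then give
the cube: `ζ ^ 3` on `Σ_u`, and `(ζ ^ 3) ^ 3 = ζ` on `Σ_v`, as `ζ ^ 8 = 1`. No presentation of the
fundamental group of `𝕌` is needed: the representation is realised by a continuous map `toPrism` to
the quotient of `ℍˣ` by this group, and values on loops are read off by lifting paths. The real part
of the holonomy is a conjugacy invariant (`holonomyRe_eq_of_isConj`) and its positivity survives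
inversion (`holonomyRe_symm_pos`), while `cos (3π/4) < 0 < cos (π/4)`.

Normal closures. The real axis cuts the four-holed sphere into two simply connected halves. In each
half, the arc of the outer circle is homotopic to the path that follows the real axis and passes
every hole on that side. If the two ways around each hole agree modulo a normal subgroup, so do the
two arcs of the outer circle (`congrMod_outer_of_inner`). Hence on `Σ_s` the outer loop lies in the
normal closure of the inner ones, whatever the orientations; the two surfaces give the two
inclusions. -/

open Classical in
/-- The unit of `ℍ` given by a nonzero quaternion, and `1` for `0`. -/
def quaternionUnit (q : ℍ) : ℍˣ := if h : q = 0 then 1 else Units.mk0 q h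

theorem quaternionUnit_val {q : ℍ} (h : q ≠ 0) : (quaternionUnit q : ℍ) = q := by
  simp [quaternionUnit, h]

theorem continuous_quaternionUnit {X : Type*} [TopologicalSpace X] {g : X → ℍ}
    (hg : Continuous g) (h : ∀ x, g x ≠ 0) : Continuous fun x => quaternionUnit (g x) := by
  refine Units.isEmbedding_val₀.continuous_iff.2 (hg.congr fun x => ?_)
  exact (quaternionUnit_val (h x)).symm

/-- The quaternion unit `j`. -/
def jUnit : ℍ := ⟨0, 0, 1, 0⟩

@[simp] theorem re_jUnit : jUnit.re = 0 := rfl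

@[simp] theorem imI_jUnit : jUnit.imI = 0 := rfl

@[simp] theorem imJ_jUnit : jUnit.imJ = 1 := rfl

@[simp] theorem imK_jUnit : jUnit.imK = 0 := rfl

theorem coeComplex_ne_zero {z : ℂ} (h : z ≠ 0) : (z : ℍ) ≠ 0 := by
  intro h0
  apply h
  apply Complex.ext
  · simpa using congrArg (fun q : ℍ => q.re) h0
  · simpa using congrArg (fun q : ℍ => q.imI) h0

theorem jUnit_ne_zero : jUnit ≠ 0 := by
  intro h0
  simpa [jUnit] using congrArg (fun q : ℍ => q.imJ) h0

theorem jUnit_mul_coeComplex (z : ℂ) : jUnit * z = (starRingEnd ℂ z : ℂ) * jUnit := by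
  ext <;> simp [Quaternion.re_mul, Quaternion.imI_mul, Quaternion.imJ_mul, Quaternion.imK_mul]

theorem jUnit_mul_jUnit : jUnit * jUnit = -1 := by
  ext <;> simp [Quaternion.re_mul, Quaternion.imI_mul, Quaternion.imJ_mul, Quaternion.imK_mul]

/-- The complex exponential as a map to the units of `ℍ`. -/
def expUnit (w : ℂ) : ℍˣ := quaternionUnit (Complex.exp w)

theorem expUnit_val (w : ℂ) : (expUnit w : ℍ) = (Complex.exp w : ℂ) :=
  quaternionUnit_val (coeComplex_ne_zero (Complex.exp_ne_zero w))

theorem continuous_coeComplex : Continuous (fun z : ℂ => (z : ℍ)) :=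
  Quaternion.ofComplex.toLinearMap.continuous_of_finiteDimensional

theorem continuous_expUnit : Continuous expUnit :=
  continuous_quaternionUnit (continuous_coeComplex.comp Complex.continuous_exp)
    fun w => coeComplex_ne_zero (Complex.exp_ne_zero w)

theorem expUnit_add (a b : ℂ) : expUnit (a + b) = expUnit a * expUnit b := by
  ext1
  simp [expUnit_val, Complex.exp_add]

/-- The binary dihedral group of order `16`: the quaternions `ζ` and `ζ j` with `ζ ∈ ℂ`,
`ζ ^ 8 = 1`. -/
def binaryDihedral : Subgroup ℍˣ where
  carrier := {g | ∃ ζ : ℂ, ζ ^ 8 = 1 ∧ ((g : ℍ) = ζ ∨ (g : ℍ) = ζ * jUnit)}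
  one_mem' := ⟨1, by simp, by simp⟩
  mul_mem' := by
    rintro a b ⟨ζ, hζ, ha⟩ ⟨ξ, hξ, hb⟩
    have hc : (starRingEnd ℂ ξ) ^ 8 = 1 := by rw [← map_pow, hξ, map_one]
    rcases ha with ha | ha <;> rcases hb with hb | hb
    · exact ⟨ζ * ξ, by rw [mul_pow, hζ, hξ, one_mul], by simp [ha, hb]⟩
    · exact ⟨ζ * ξ, by rw [mul_pow, hζ, hξ, one_mul], by simp [ha, hb, mul_assoc]⟩
    · refine ⟨ζ * starRingEnd ℂ ξ, by rw [mul_pow, hζ, hc, one_mul], Or.inr ?_⟩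
      rw [Units.val_mul, ha, hb, mul_assoc, jUnit_mul_coeComplex, Quaternion.coeComplex_mul,
        mul_assoc]
    · refine ⟨ζ * starRingEnd ℂ ξ * (-1), by rw [mul_pow, mul_pow, hζ, hc]; norm_num, Or.inl ?_⟩
      rw [Units.val_mul, ha, hb, mul_assoc, ← mul_assoc jUnit, jUnit_mul_coeComplex, mul_assoc,
        jUnit_mul_jUnit, Quaternion.coeComplex_mul, Quaternion.coeComplex_mul, mul_assoc]
      congr 2
      ext <;> simp
  inv_mem' := by
    rintro a ⟨ζ, hζ, ha⟩
    have h0 : ζ ≠ 0 := by rintro rfl; norm_num at hζ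
    rcases ha with ha | ha
    · refine ⟨ζ⁻¹, by rw [inv_pow, hζ, inv_one], Or.inl ?_⟩
      rw [Units.val_inv_eq_inv_val, inv_eq_of_mul_eq_one_right]
      rw [ha, ← Quaternion.coeComplex_mul, mul_inv_cancel₀ h0, Quaternion.coeComplex_one]
    -- Moving `j` past a complex number conjugates it, and `j * j = -1`.
    · refine ⟨(starRingEnd ℂ ζ)⁻¹ * (-1), ?_, Or.inr ?_⟩
      · rw [mul_pow, inv_pow, ← map_pow, hζ]; norm_num
      rw [Units.val_inv_eq_inv_val, inv_eq_of_mul_eq_one_right]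
      rw [ha, mul_assoc, ← mul_assoc jUnit, jUnit_mul_coeComplex, mul_assoc, jUnit_mul_jUnit,
        ← mul_assoc, ← Quaternion.coeComplex_mul, map_mul, map_inv₀, Complex.conj_conj, map_neg,
        map_one, ← mul_assoc, mul_inv_cancel₀ h0]
      ext <;> simp

theorem finite_binaryDihedral : (binaryDihedral : Set ℍˣ).Finite := by
  have hfin : {ζ : ℂ | ζ ^ 8 = 1}.Finite := by
    refine ((Polynomial.nthRoots 8 (1 : ℂ)).toFinset.finite_toSet).subset fun ζ hζ => ?_
    simpa [Polynomial.mem_nthRoots] using hζ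
  refine Set.Finite.of_finite_image (f := fun g : ℍˣ => (g : ℍ)) ?_ Units.val_injective.injOn
  refine ((hfin.image fun ζ : ℂ => (ζ : ℍ)).union
    (hfin.image fun ζ : ℂ => (ζ : ℍ) * jUnit)).subset ?_
  rintro _ ⟨g, ⟨ζ, hζ, h | h⟩, rfl⟩
  · exact Or.inl ⟨ζ, hζ, h.symm⟩
  · exact Or.inr ⟨ζ, hζ, h.symm⟩

/-- The quotient of the group of units of `ℍ` by the binary dihedral group of order `16`. -/
abbrev PrismSpace : Type := ℍˣ ⧸ binaryDihedral

theorem isQuotientCoveringMap_mk :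
    IsQuotientCoveringMap (QuotientGroup.mk : ℍˣ → PrismSpace) binaryDihedral.op :=
  have := finite_binaryDihedral.to_subtype
  binaryDihedral.isQuotientCoveringMap ⟨inferInstance⟩

/-- The class of the eighth roots of `z` (for `z ≠ 0`). -/
def rootClass (z : ℂ) : PrismSpace := QuotientGroup.mk (expUnit (Complex.log z / 8))

theorem rootClass_exp (w : ℂ) : rootClass (Complex.exp w) = QuotientGroup.mk (expUnit (w / 8)) := by
  obtain ⟨n, hn⟩ := Complex.exp_eq_exp_iff_exists_int.1
    (Complex.exp_log (Complex.exp_ne_zero w)).symm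
  -- Two logarithms differ by a multiple of `2πi`, so their eighths differ by an eighth root of
  -- unity after exponentiation.
  refine QuotientGroup.eq.2 ⟨Complex.exp ((w - Complex.log (Complex.exp w)) / 8), ?_, Or.inl ?_⟩
  · rw [← Complex.exp_nat_mul, Complex.exp_eq_one_iff]
    refine ⟨n, ?_⟩
    push_cast
    linear_combination hn
  · rw [← expUnit_val, Units.val_inj, inv_mul_eq_iff_eq_mul, ← expUnit_add]
    congr 1
    ring

/-- The jump of `Complex.log` is harmless: `exp` is a quotient map onto the nonzero numbers, and
composed with it the map is visibly continuous. -/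
theorem continuous_rootClass {X : Type*} [TopologicalSpace X] {g : X → ℂ} (hg : Continuous g)
    (h : ∀ x, g x ≠ 0) : Continuous fun x => rootClass (g x) := by
  have key : Continuous fun z : {z : ℂ // z ≠ 0} => rootClass z := by
    refine (Complex.isCoveringMap_exp.isQuotientMap
      fun z => ⟨_, Subtype.ext (Complex.exp_log z.2)⟩).continuous_iff.2 ?_
    refine (QuotientGroup.continuous_mk.comp
      (continuous_expUnit.comp (continuous_id.div_const (8 : ℂ)))).congr fun w => ?_
    exact (rootClass_exp w).symm
  exact key.comp (hg.subtype_mk h)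

/-- This is how a circle can be reversed: left multiplication by `j` is homotopic to the identity,
and the `j` that appears on the right is absorbed by the subgroup. -/
theorem jUnit_smul_rootClass {z : ℂ} (hz : z ≠ 0) :
    quaternionUnit jUnit • rootClass (starRingEnd ℂ z) = rootClass z := by
  obtain ⟨w, rfl⟩ : ∃ w, Complex.exp w = z := ⟨_, Complex.exp_log hz⟩
  rw [← Complex.exp_conj, rootClass_exp, rootClass_exp, MulAction.Quotient.smul_mk, eq_comm]
  refine QuotientGroup.eq.2 ⟨1, one_pow _, Or.inr ?_⟩
  rw [Quaternion.coeComplex_one, one_mul, ← quaternionUnit_val jUnit_ne_zero, Units.val_inj,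
    inv_mul_eq_iff_eq_mul]
  ext1
  have : (starRingEnd ℂ w) / 8 = starRingEnd ℂ (w / 8) := by rw [map_div₀, Complex.conj_ofNat]
  rw [smul_eq_mul, Units.val_mul, Units.val_mul, expUnit_val,
    expUnit_val, this, Complex.exp_conj, quaternionUnit_val jUnit_ne_zero,
    quaternionUnit_val jUnit_ne_zero, jUnit_mul_coeComplex, Complex.conj_conj]

theorem rootClass_mul_pow {z y : ℂ} (hz : z ≠ 0) (hy : y ≠ 0) :
    rootClass (z * y ^ 8) = quaternionUnit y • rootClass z := by
  obtain ⟨w, rfl⟩ : ∃ w, Complex.exp w = z := ⟨_, Complex.exp_log hz⟩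
  obtain ⟨v, rfl⟩ : ∃ v, Complex.exp v = y := ⟨_, Complex.exp_log hy⟩
  rw [← Complex.exp_nat_mul, ← Complex.exp_add, rootClass_exp, rootClass_exp,
    MulAction.Quotient.smul_mk, smul_eq_mul]
  change _ = QuotientGroup.mk (expUnit v * _)
  rw [← expUnit_add]
  congr 2
  push_cast
  ring

/-! ## The map from `𝕌` to `PrismSpace` -/

/-- The point of the plane underlying a point of the four-holed sphere. -/
def FourHoledSphere.toComplex (p : FourHoledSphere) : ℂ := Subtype.val p

theorem FourHoledSphere.continuous_toComplex : Continuous FourHoledSphere.toComplex :=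
  continuous_subtype_val

theorem continuous_circleCoe : Continuous fun z : Circle => (z : ℂ) := by fun_prop

theorem continuous_boundaryPoint (i : Fin 4) : Continuous (boundaryPoint i) := by
  match i with
  | 0 => exact continuous_const.mul continuous_circleCoe
  | 1 => exact continuous_const.add ((Complex.continuous_conj.comp continuous_circleCoe).div_const 2)
  | 2 => exact (Complex.continuous_conj.comp continuous_circleCoe).div_const 2
  | 3 => exact continuous_const.add (continuous_circleCoe.div_const 2)

theorem continuous_boundaryCircle (i : Fin 4) : Continuous (boundaryCircle i) :=
  (continuous_boundaryPoint i).subtype_mk _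

/-! ### Straightening the polynomial on the boundary circles -/

/-- The polynomial that vanishes at the centres of the three holes, rotated by a right angle. -/
def holePolynomial (w : ℂ) : ℂ := Complex.I * (w ^ 3 - 4 * w)

theorem continuous_holePolynomial : Continuous holePolynomial := by
  unfold holePolynomial; fun_prop

theorem holePolynomial_ne_zero (p : FourHoledSphere) : holePolynomial p.toComplex ≠ 0 := by
  obtain ⟨w, -, h1, h2, h3⟩ := p
  have h1' : w + 2 ≠ 0 := by intro h; rw [h, norm_zero] at h1; norm_num at h1
  have h2' : w ≠ 0 := by intro h; rw [h, norm_zero] at h2; norm_num at h2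
  have h3' : w - 2 ≠ 0 := by intro h; rw [h, norm_zero] at h3; norm_num at h3
  change Complex.I * (w ^ 3 - 4 * w) ≠ 0
  rw [show w ^ 3 - 4 * w = w * (w + 2) * (w - 2) by ring]
  exact mul_ne_zero Complex.I_ne_zero (mul_ne_zero (mul_ne_zero h2' h1') h3')

/-- The monomial (in `z` and `z⁻¹`) that is homotopic to `holePolynomial` on the `i`-th boundary
circle. -/
def boundaryMonomial : Fin 4 → Circle → ℂ
  | 0, z => (z : ℂ) ^ 3
  | 1, z => starRingEnd ℂ (z : ℂ)
  | 2, z => starRingEnd ℂ (z : ℂ)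
  | 3, z => (z : ℂ)

theorem continuous_boundaryMonomial (i : Fin 4) : Continuous (boundaryMonomial i) := by
  match i with
  | 0 => exact continuous_circleCoe.pow 3
  | 1 => exact Complex.continuous_conj.comp continuous_circleCoe
  | 2 => exact Complex.continuous_conj.comp continuous_circleCoe
  | 3 => exact continuous_circleCoe

theorem norm_boundaryMonomial (i : Fin 4) (z : Circle) : ‖boundaryMonomial i z‖ = 1 := by
  match i with
  | 0 => simp [boundaryMonomial, Circle.norm_coe]
  | 1 => simp [boundaryMonomial, Circle.norm_coe]
  | 2 => simp [boundaryMonomial, Circle.norm_coe]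
  | 3 => simp [boundaryMonomial, Circle.norm_coe]

/-- Without the factor `I`, the quotient by the monomial has real part of constant sign, because one
constant term dominates. That sign is negative on circle `2`, where a straight segment to the
monomial could meet `0`; the factor `I` turns the real part into an imaginary part, for which either
sign will do. -/
theorem im_holePolynomial_mul_conj (i : Fin 4) (z : Circle) :
    (holePolynomial (boundaryPoint i z) * starRingEnd ℂ (boundaryMonomial i z)).im ≠ 0 := by
  have h : (z : ℂ) * starRingEnd ℂ (z : ℂ) = 1 := by
    rw [Complex.mul_conj, Circle.normSq_coe, Complex.ofReal_one]
  have hn : (z : ℂ).re ^ 2 + (z : ℂ).im ^ 2 = 1 := by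
    rw [← Circle.normSq_coe z, Complex.normSq_apply]; ring
  have hre : -1 ≤ (z : ℂ).re ∧ (z : ℂ).re ≤ 1 := by constructor <;> nlinarith
  have key : holePolynomial (boundaryPoint i z) * starRingEnd ℂ (boundaryMonomial i z) =
      Complex.I * match i with
        | 0 => 64 - 16 * (starRingEnd ℂ (z : ℂ)) ^ 2
        | 1 => 4 - 3 / 2 * starRingEnd ℂ (z : ℂ) + (starRingEnd ℂ (z : ℂ)) ^ 2 / 8
        | 2 => -2 + (starRingEnd ℂ (z : ℂ)) ^ 2 / 8
        | 3 => 4 + 3 / 2 * (z : ℂ) + (z : ℂ) ^ 2 / 8 := by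
    match i with
    | 0 =>
      simp only [holePolynomial, boundaryPoint, boundaryMonomial, map_pow]
      linear_combination Complex.I * (64 * ((z : ℂ) ^ 2 * (starRingEnd ℂ (z : ℂ)) ^ 2 +
        (z : ℂ) * starRingEnd ℂ (z : ℂ) + 1) - 16 * (starRingEnd ℂ (z : ℂ)) ^ 2) * h
    | 1 =>
      simp only [holePolynomial, boundaryPoint, boundaryMonomial, Complex.conj_conj]
      linear_combination Complex.I * (4 - 3 / 2 * starRingEnd ℂ (z : ℂ) +
        (starRingEnd ℂ (z : ℂ)) ^ 2 / 8) * h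
    | 2 =>
      simp only [holePolynomial, boundaryPoint, boundaryMonomial, Complex.conj_conj]
      linear_combination Complex.I * (-2 + (starRingEnd ℂ (z : ℂ)) ^ 2 / 8) * h
    | 3 =>
      simp only [holePolynomial, boundaryPoint, boundaryMonomial]
      linear_combination Complex.I * (4 + 3 / 2 * (z : ℂ) + (z : ℂ) ^ 2 / 8) * h
  rw [key, Complex.I_mul_im]
  match i with
  | 0 => simp [pow_two]; nlinarith
  | 1 => simp [pow_two]; nlinarith
  | 2 => simp [pow_two]; nlinarith
  | 3 => simp [pow_two]; nlinarith

/-- After multiplication by the conjugate of `e`, the segment runs from a non-real number to `1`, so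
it is real only at its end. -/
theorem segment_ne_zero {a e : ℂ} (he : ‖e‖ = 1) (h : (a * starRingEnd ℂ e).im ≠ 0) (t : ℝ) :
    (1 - t) * a + t * e ≠ 0 := by
  intro h0
  have h1 : ((1 - t : ℝ) : ℂ) * (a * starRingEnd ℂ e) + (t : ℂ) = 0 := by
    have : e * starRingEnd ℂ e = 1 := by rw [Complex.mul_conj, Complex.normSq_eq_norm_sq, he]; simp
    push_cast
    linear_combination (starRingEnd ℂ e) * h0 - t * this
  have him := congrArg Complex.im h1
  rw [Complex.add_im, Complex.im_ofReal_mul, Complex.ofReal_im, add_zero, Complex.zero_im] at him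
  have ht : 1 - t = 0 := (mul_eq_zero.1 him).resolve_right h
  rw [← Complex.ofReal_one, ← Complex.ofReal_sub, ht] at h0
  have : t = 1 := by linarith
  rw [this] at h0
  simp at h0
  simp [h0] at he

/-- The exponent of `holePolynomial` in the map from `Σ_s` to the plane. -/
def exponent : Label → ℕ
  | .u => 1
  | .v => 3

/-- The number of full turns of the eighth root by which the outer boundary circle of `Σ_s` differs
from its vertex circle. -/
def turns : Label → ℕ
  | .u => 0
  | .v => 1

/-- The winding number of the outer circle only has to be right modulo `8`: the case `v` is `9 = 1 +
8`. -/
theorem three_mul_exponent (s : Label) : 3 * exponent s = exponent s.other + 8 * turns s := by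
  cases s <;> rfl

/-- The quaternion by which the map on the cylinder is twisted at its end on a vertex circle. -/
def endTwist (s : Label) : Fin 4 → Circle → ℍ
  | 0, z => ((starRingEnd ℂ (z : ℂ)) ^ turns s : ℂ)
  | 1, _ => jUnit
  | 2, _ => jUnit
  | 3, _ => 1

/-- A homotopy through nonzero quaternions from `1` to `endTwist s i`. -/
def twist (s : Label) (i : Fin 4) (t : ℝ) (z : Circle) : ℍ :=
  (1 - t) • (1 + t • jUnit) + t • endTwist s i z

theorem continuous_endTwist (s : Label) (i : Fin 4) : Continuous (endTwist s i) := by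
  match i with
  | 0 =>
    exact continuous_coeComplex.comp
      ((Complex.continuous_conj.comp continuous_circleCoe).pow (turns s))
  | 1 => exact continuous_const
  | 2 => exact continuous_const
  | 3 => exact continuous_const

theorem endTwist_ne_zero (s : Label) (i : Fin 4) (z : Circle) : endTwist s i z ≠ 0 := by
  match i with
  | 0 => exact coeComplex_ne_zero (pow_ne_zero _ (by simp))
  | 1 => exact jUnit_ne_zero
  | 2 => exact jUnit_ne_zero
  | 3 => exact one_ne_zero

theorem twist_zero (s : Label) (i : Fin 4) (z : Circle) : twist s i 0 z = 1 := by
  simp [twist]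

theorem twist_one (s : Label) (i : Fin 4) (z : Circle) : twist s i 1 z = endTwist s i z := by
  simp [twist]

theorem twist_ne_zero (s : Label) (i : Fin 4) (t : ℝ) (z : Circle) : twist s i t z ≠ 0 := by
  rcases eq_or_ne t 1 with rfl | ht
  · rw [twist_one]; exact endTwist_ne_zero s i z
  rcases eq_or_ne t 0 with rfl | ht0
  · rw [twist_zero]; exact one_ne_zero
  intro h0
  have hre := congrArg (fun q : ℍ => q.re) h0
  have him := congrArg (fun q : ℍ => q.imJ) h0
  have ht' : 1 - t ≠ 0 := sub_ne_zero.2 (Ne.symm ht)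
  -- The `j`-component `t (1 - t)` excludes zero on circles `0` and `3`; where `endTwist` is `j`
  -- itself, the real part `1 - t` does.
  match i with
  | 0 =>
    simp only [twist, endTwist, Quaternion.imJ_add, Quaternion.imJ_smul, Quaternion.imJ_one,
      imJ_jUnit, Quaternion.imJ_coeComplex, Quaternion.imJ_zero, smul_eq_mul] at him
    simp [ht', ht0] at him
  | 1 => simp [twist, endTwist, ht'] at hre
  | 2 => simp [twist, endTwist, ht'] at hre
  | 3 => simp [twist, endTwist, ht', ht0] at him

/-- The map on the cylinder over the edge `(s, i)`. -/
def cylinderMap (s : Label) (i : Fin 4) (t : ℝ) (z : Circle) : PrismSpace :=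
  quaternionUnit (twist s i t z) •
    rootClass (((1 - t) * holePolynomial (boundaryPoint i z) + t * boundaryMonomial i z)
      ^ exponent s)

theorem quaternionUnit_one : quaternionUnit 1 = 1 :=
  Units.ext (quaternionUnit_val one_ne_zero)

theorem cylinderMap_zero (s : Label) (i : Fin 4) (z : Circle) :
    cylinderMap s i 0 z = rootClass (holePolynomial (boundaryPoint i z) ^ exponent s) := by
  simp [cylinderMap, twist_zero, quaternionUnit_one]

/-- The twist repairs the mismatch with the vertex circle: it removes surplus full turns of the
eighth root on circle `0`, undoes the conjugation on circles `1` and `2`, and is trivial on circle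
`3`. -/
theorem cylinderMap_one (s : Label) (i : Fin 4) (z : Circle) :
    cylinderMap s i 1 z = rootClass ((z : ℂ) ^ exponent (target s i).other) := by
  have key : ∀ i ≠ 0, (target s i).other = s := by
    intro i hi; simp only [target, hi, if_false]; cases s <;> rfl
  have hj : quaternionUnit jUnit • rootClass ((starRingEnd ℂ (z : ℂ)) ^ exponent s) =
      rootClass ((z : ℂ) ^ exponent s) := by
    rw [← map_pow, jUnit_smul_rootClass (pow_ne_zero _ z.coe_ne_zero)]
  have h1 : cylinderMap s i 1 z =
      quaternionUnit (endTwist s i z) • rootClass (boundaryMonomial i z ^ exponent s) := by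
    simp [cylinderMap, twist_one]
  rw [h1]
  fin_cases i
  · have hz : starRingEnd ℂ (z : ℂ) ≠ 0 := by simp
    have hc : (z : ℂ) * starRingEnd ℂ (z : ℂ) = 1 := by
      rw [Complex.mul_conj, Circle.normSq_coe, Complex.ofReal_one]
    change quaternionUnit (((starRingEnd ℂ (z : ℂ)) ^ turns s : ℂ) : ℍ) •
      rootClass (((z : ℂ) ^ 3) ^ exponent s) = rootClass ((z : ℂ) ^ exponent s.other)
    rw [← rootClass_mul_pow (pow_ne_zero _ (pow_ne_zero _ z.coe_ne_zero)) (pow_ne_zero _ hz),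
      ← pow_mul, three_mul_exponent, pow_add, mul_assoc, ← pow_mul, mul_comm (turns s) 8, ← mul_pow,
      hc, one_pow, mul_one]
  · rw [key _ (by decide)]; exact hj
  · rw [key _ (by decide)]; exact hj
  · rw [key _ (by decide)]
    change quaternionUnit 1 • rootClass ((z : ℂ) ^ exponent s) = _
    rw [quaternionUnit_one, one_smul]

theorem continuous_cylinderMap (s : Label) (i : Fin 4) :
    Continuous fun p : I × Circle => cylinderMap s i p.1 p.2 := by
  unfold cylinderMap
  have hu : Continuous fun p : I × Circle => twist s i p.1 p.2 := by
    have := continuous_endTwist s i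
    unfold twist
    fun_prop
  have hr : Continuous fun p : I × Circle => ((1 - (p.1 : ℝ)) * holePolynomial (boundaryPoint i p.2)
      + (p.1 : ℝ) * boundaryMonomial i p.2) ^ exponent s := by
    have h1 := continuous_boundaryMonomial i
    have h2 := continuous_boundaryPoint i
    have h3 := continuous_holePolynomial
    fun_prop
  have hu' := continuous_quaternionUnit hu fun p => twist_ne_zero s i p.1 p.2
  have hr' := continuous_rootClass hr fun p => pow_ne_zero _ (segment_ne_zero
    (norm_boundaryMonomial i p.2) (im_holePolynomial_mul_conj i p.2) p.1)
  exact hu'.smul hr'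

/-- The map from the disjoint union of the pieces to `PrismSpace`. -/
def piecesToPrism : Pieces → PrismSpace :=
  Sum.elim
    (Sum.elim (fun p => rootClass ((p.2 : ℂ) ^ exponent p.1.other))
      (fun p => rootClass (holePolynomial p.2.toComplex ^ exponent p.1)))
    (fun p => cylinderMap p.1.1 p.1.2 p.2.1 p.2.2)

theorem continuous_piecesToPrism : Continuous piecesToPrism := by
  refine Continuous.sumElim (Continuous.sumElim ?_ ?_) ?_ <;> refine continuous_sigma fun s => ?_
  · have h : Continuous fun z : Circle => (z : ℂ) ^ exponent s.other :=
      continuous_circleCoe.pow (exponent s.other)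
    exact continuous_rootClass h fun z => pow_ne_zero _ z.coe_ne_zero
  · have h : Continuous fun p : FourHoledSphere => holePolynomial p.toComplex ^ exponent s :=
      (continuous_holePolynomial.comp FourHoledSphere.continuous_toComplex).pow (exponent s)
    exact continuous_rootClass h fun p => pow_ne_zero _ (holePolynomial_ne_zero p)
  · exact continuous_cylinderMap s.1 s.2

/-- A map from `𝕌` to `PrismSpace` that tells the two vertex circles apart. -/
def toPrism : C(U, PrismSpace) where
  toFun := Quot.lift piecesToPrism (by
    rintro _ _ (⟨s, i, z⟩ | ⟨s, i, z⟩)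
    · exact cylinderMap_zero s i z
    · exact cylinderMap_one s i z)
  continuous_toFun := continuous_quot_lift _ continuous_piecesToPrism

theorem toPrism_circlePoint (s : Label) (z : Circle) :
    toPrism (circlePoint s z) = rootClass ((z : ℂ) ^ exponent s.other) := rfl

theorem toPrism_circlePoint_exp (s : Label) (t : ℝ) :
    toPrism (circlePoint s (Circle.exp (2 * Real.pi * t))) =
      QuotientGroup.mk (expUnit (exponent s.other * (2 * Real.pi * t * Complex.I) / 8)) := by
  rw [toPrism_circlePoint, Circle.coe_exp, ← Complex.exp_nat_mul, rootClass_exp]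
  push_cast
  rfl

/-! ## Monodromy in `PrismSpace` -/

/-- Transport of points of `ℍˣ` along the image in `PrismSpace` of a path. -/
def transport {X : Type*} [TopologicalSpace X] (f : C(X, PrismSpace)) {x y : X}
    (γ : Path.Homotopic.Quotient x y) :
    (QuotientGroup.mk ⁻¹' {f x} : Set ℍˣ) → (QuotientGroup.mk ⁻¹' {f y} : Set ℍˣ) :=
  isQuotientCoveringMap_mk.isCoveringMap.monodromy (γ.map f)

section Transport

variable {X : Type*} [TopologicalSpace X] (f : C(X, PrismSpace)) {x y z : X}

theorem transport_trans (γ : Path.Homotopic.Quotient x y) (δ : Path.Homotopic.Quotient y z)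
    (e : (QuotientGroup.mk ⁻¹' {f x} : Set ℍˣ)) :
    transport f (γ.trans δ) e = transport f δ (transport f γ e) := by
  have : (γ.trans δ).map f = (γ.map f).trans (δ.map f) := by
    obtain ⟨γ⟩ := γ
    obtain ⟨δ⟩ := δ
    exact congrArg Path.Homotopic.Quotient.mk (Path.map_trans γ δ f.continuous)
  rw [transport, this, IsCoveringMap.monodromy_trans_apply]
  rfl

theorem transport_symm (γ : Path.Homotopic.Quotient x y)
    (e : (QuotientGroup.mk ⁻¹' {f x} : Set ℍˣ)) :
    transport f γ.symm (transport f γ e) = e := by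
  rw [← transport_trans, Path.Homotopic.Quotient.trans_symm]
  exact congrFun isQuotientCoveringMap_mk.isCoveringMap.monodromy_refl e

/-- Points of a fibre differ by right multiplication by the subgroup; these are deck transformations
and commute with monodromy. -/
theorem transport_mul (γ : Path.Homotopic.Quotient x y)
    (e e' : (QuotientGroup.mk ⁻¹' {f x} : Set ℍˣ)) :
    (transport f γ e' : ℍˣ) = transport f γ e * ((e : ℍˣ)⁻¹ * e') := by
  obtain ⟨g, rfl⟩ := isQuotientCoveringMap_mk.exists_toPermFiber_eq e e'
  rw [transport, isQuotientCoveringMap_mk.monodromy_toPermFiber]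
  simp [isQuotientCoveringMap_mk.toPermFiber_apply_apply_coe, Subgroup.smul_def]

theorem transport_mk (γ : Path x y) (Γ : I → ℍˣ) (hΓ : Continuous Γ)
    (h : ∀ t, QuotientGroup.mk (Γ t) = f (γ t)) :
    transport f (Path.Homotopic.Quotient.mk γ)
      ⟨Γ 0, (h 0).trans (congrArg f γ.source)⟩ = ⟨Γ 1, (h 1).trans (congrArg f γ.target)⟩ := by
  refine isQuotientCoveringMap_mk.isCoveringMap.monodromy_eq_of_map_eq
    (Path.Homotopic.Quotient.mk ⟨⟨Γ, hΓ⟩, rfl, rfl⟩) ?_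
  refine congrArg Path.Homotopic.Quotient.mk ?_
  ext t
  exact h t

/-- The real part of the holonomy of a loop. -/
def holonomyRe (γ : Path.Homotopic.Quotient x x)
    (e : (QuotientGroup.mk ⁻¹' {f x} : Set ℍˣ)) : ℝ :=
  (((e : ℍˣ)⁻¹ * transport f γ e : ℍˣ) : ℍ).re

theorem re_conj_unit (g h : ℍˣ) : ((g⁻¹ * h * g : ℍˣ) : ℍ).re = (h : ℍ).re := by
  have comm : ∀ a b : ℍ, (a * b).re = (b * a).re := by
    intro a b; simp only [Quaternion.re_mul]; ring
  rw [Units.val_mul, comm, ← Units.val_mul, mul_inv_cancel_left]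

/-- Another point of the fibre conjugates the holonomy, and the real part of a quaternion is a
conjugacy invariant. -/
theorem holonomyRe_eq (γ : Path.Homotopic.Quotient x x)
    (e e' : (QuotientGroup.mk ⁻¹' {f x} : Set ℍˣ)) :
    holonomyRe f γ e' = holonomyRe f γ e := by
  have key : (e' : ℍˣ)⁻¹ * (transport f γ e * ((e : ℍˣ)⁻¹ * e')) =
      ((e : ℍˣ)⁻¹ * e')⁻¹ * ((e : ℍˣ)⁻¹ * transport f γ e) * ((e : ℍˣ)⁻¹ * e') := by group
  rw [holonomyRe, holonomyRe, transport_mul f γ e e', key, re_conj_unit]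

theorem holonomyRe_conj (δ : Path.Homotopic.Quotient x y) (γ : Path.Homotopic.Quotient y y)
    (e : (QuotientGroup.mk ⁻¹' {f x} : Set ℍˣ)) (e' : (QuotientGroup.mk ⁻¹' {f y} : Set ℍˣ)) :
    holonomyRe f (δ.trans (γ.trans δ.symm)) e = holonomyRe f γ e' := by
  rw [← holonomyRe_eq f γ e' (transport f δ e), holonomyRe, holonomyRe, transport_trans,
    transport_trans, transport_mul f δ.symm (transport f δ e), transport_symm,
    inv_mul_cancel_left]

/-- The reversed loop has the inverse holonomy, and `q⁻¹` is the conjugate of `q` divided by its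
positive norm. -/
theorem holonomyRe_symm_pos (γ : Path.Homotopic.Quotient x x)
    (e : (QuotientGroup.mk ⁻¹' {f x} : Set ℍˣ)) (h : 0 < holonomyRe f γ e) :
    0 < holonomyRe f γ.symm e := by
  have key : (e : ℍˣ)⁻¹ * transport f γ.symm e = ((e : ℍˣ)⁻¹ * transport f γ e)⁻¹ := by
    rw [transport_mul f γ.symm (transport f γ e) e, transport_symm, inv_mul_cancel_left, mul_inv_rev,
      inv_inv]
  have hpos : 0 < Quaternion.normSq (((e : ℍˣ)⁻¹ * transport f γ e : ℍˣ) : ℍ) :=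
    lt_of_le_of_ne Quaternion.normSq_nonneg
      (Ne.symm (Quaternion.normSq_ne_zero.2 (Units.ne_zero _)))
  rw [holonomyRe, key, Units.val_inv_eq_inv_val, Quaternion.inv_def, Quaternion.re_smul,
    Quaternion.re_star]
  exact mul_pos (inv_pos.2 hpos) h

theorem quotient_symm_symm (γ : Path.Homotopic.Quotient x y) : γ.symm.symm = γ := by
  obtain ⟨γ⟩ := γ
  exact congrArg Path.Homotopic.Quotient.mk γ.symm_symm

theorem holonomyRe_eq_of_isConj {p q : FundamentalGroup X x} (h : IsConj p q)
    (e : (QuotientGroup.mk ⁻¹' {f x} : Set ℍˣ)) : holonomyRe f p e = holonomyRe f q e := by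
  obtain ⟨c, rfl⟩ := isConj_iff.1 h
  -- The product of the group traverses its right factor first.
  have : c * p * c⁻¹ = Path.Homotopic.Quotient.trans (Path.Homotopic.Quotient.symm c)
      (Path.Homotopic.Quotient.trans p (Path.Homotopic.Quotient.symm
        (Path.Homotopic.Quotient.symm c))) := by
    rw [quotient_symm_symm]
    rfl
  rw [this, holonomyRe_conj f _ _ _ e]

end Transport

/-- The tail `γ` only conjugates, and the circle has an explicit lift `Γ` that starts at `1`. -/
theorem holonomyRe_loopElement (s : Label) {x : U} (γ : Path x (circlePoint s 1))
    (e : (QuotientGroup.mk ⁻¹' {toPrism x} : Set ℍˣ)) :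
    holonomyRe toPrism (loopElement s γ) e = Real.cos (exponent s.other * Real.pi / 4) := by
  have hl : loopElement s γ = (Path.Homotopic.Quotient.mk γ).trans
      ((Path.Homotopic.Quotient.mk (circleLoop s)).trans (Path.Homotopic.Quotient.mk γ).symm) :=
    Path.Homotopic.Quotient.trans_assoc (Path.Homotopic.Quotient.mk γ)
      (Path.Homotopic.Quotient.mk (circleLoop s)) (Path.Homotopic.Quotient.mk γ).symm
  let Γ : I → ℍˣ := fun t => expUnit (exponent s.other * (2 * Real.pi * (t : ℝ) * Complex.I) / 8)
  have hΓ : Continuous Γ := continuous_expUnit.comp (by fun_prop)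
  have h : ∀ t, QuotientGroup.mk (Γ t) = toPrism (circleLoop s t) := fun t =>
    (toPrism_circlePoint_exp s t).symm
  have ht := transport_mk toPrism (circleLoop s) Γ hΓ h
  rw [hl, holonomyRe_conj toPrism _ _ _ ⟨Γ 0, (h 0).trans (congrArg _ (circleLoop s).source)⟩,
    holonomyRe, ht]
  have h0 : Γ 0 = 1 := by
    ext1; simp [Γ, expUnit_val]
  simp only [h0, inv_one, one_mul]
  simp only [Γ, expUnit_val, Quaternion.re_coeComplex]
  rw [← Complex.exp_ofReal_mul_I_re]
  congr 2
  push_cast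
  simp
  ring

theorem pmClass_loopElement_ne {x : U} (γu : Path x (circlePoint .u 1))
    (γv : Path x (circlePoint .v 1)) :
    pmClass (loopElement .u γu) ≠ pmClass (loopElement .v γv) := by
  intro h
  obtain ⟨e, he⟩ := QuotientGroup.mk_surjective (s := binaryDihedral) (toPrism x)
  have hu := holonomyRe_loopElement .u γu ⟨e, he⟩
  have hv := holonomyRe_loopElement .v γv ⟨e, he⟩
  have hu' : holonomyRe toPrism (loopElement .u γu) ⟨e, he⟩ ≤ 0 := by
    rw [hu]
    -- The angle is `3π/4` for `u`, and `π/4` for `v` below.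
    apply Real.cos_nonpos_of_pi_div_two_le_of_le <;> simp [exponent, Label.other] <;>
      nlinarith [Real.pi_pos]
  have hv' : 0 < holonomyRe toPrism (loopElement .v γv) ⟨e, he⟩ := by
    rw [hv]
    apply Real.cos_pos_of_mem_Ioo
    constructor <;> simp [exponent, Label.other] <;> nlinarith [Real.pi_pos]
  rcases Quotient.exact h with h | h
  · rw [holonomyRe_eq_of_isConj toPrism h] at hu'
    exact absurd hv' (not_lt.2 hu')
  · rw [holonomyRe_eq_of_isConj toPrism h] at hu'
    exact absurd (holonomyRe_symm_pos toPrism _ _ hv') (not_lt.2 hu')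

/-! ## The halves of the four-holed sphere are simply connected -/

theorem mem_fourHoledSphere_iff (w : ℂ) :
    (‖w‖ ≤ 4 ∧ 1 / 2 ≤ ‖w + 2‖ ∧ 1 / 2 ≤ ‖w‖ ∧ 1 / 2 ≤ ‖w - 2‖) ↔
      w.re ^ 2 + w.im ^ 2 ≤ 16 ∧ 1 / 4 ≤ (w.re + 2) ^ 2 + w.im ^ 2 ∧
        1 / 4 ≤ w.re ^ 2 + w.im ^ 2 ∧ 1 / 4 ≤ (w.re - 2) ^ 2 + w.im ^ 2 := by
  have hsq : ∀ z : ℂ, z.re ^ 2 + z.im ^ 2 = ‖z‖ ^ 2 := fun z => by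
    rw [← Complex.normSq_eq_norm_sq, Complex.normSq_apply]; ring
  have h1 : (w.re + 2) ^ 2 + w.im ^ 2 = ‖w + 2‖ ^ 2 := by rw [← hsq]; simp
  have h2 : (w.re - 2) ^ 2 + w.im ^ 2 = ‖w - 2‖ ^ 2 := by rw [← hsq]; simp
  have half : ∀ r : ℝ, 0 ≤ r → (1 / 2 ≤ r ↔ 1 / 4 ≤ r ^ 2) := fun r hr => by
    rw [show (1 / 4 : ℝ) = (1 / 2) ^ 2 by norm_num, sq_le_sq₀ (by norm_num) hr]
  have four : ∀ r : ℝ, 0 ≤ r → (r ≤ 4 ↔ r ^ 2 ≤ 16) := fun r hr => by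
    rw [show (16 : ℝ) = 4 ^ 2 by norm_num, sq_le_sq₀ hr (by norm_num)]
  rw [h1, h2, hsq, half _ (norm_nonneg _), half _ (norm_nonneg _), half _ (norm_nonneg _),
    four _ (norm_nonneg _)]

theorem FourHoledSphere.mem (p : FourHoledSphere) :
    p.toComplex.re ^ 2 + p.toComplex.im ^ 2 ≤ 16 ∧
      1 / 4 ≤ (p.toComplex.re + 2) ^ 2 + p.toComplex.im ^ 2 ∧
        1 / 4 ≤ p.toComplex.re ^ 2 + p.toComplex.im ^ 2 ∧
          1 / 4 ≤ (p.toComplex.re - 2) ^ 2 + p.toComplex.im ^ 2 :=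
  (mem_fourHoledSphere_iff _).1 p.2

/-- The upper (`ε = 1`) or lower (`ε = -1`) half of the four-holed sphere. -/
abbrev HalfSphere (ε : ℝ) : Type := {p : FourHoledSphere // 0 ≤ ε * p.toComplex.im}

theorem continuous_toHalfSphere {X : Type*} [TopologicalSpace X] {ε : ℝ} {g : X → HalfSphere ε}
    (h : Continuous fun x => (g x).1.toComplex) : Continuous g :=
  (IsEmbedding.subtypeVal.continuous_iff.2 (IsEmbedding.subtypeVal.continuous_iff.2 h))

/-- The vertical segment from a point of a half sphere to the outer boundary circle stays in the
half sphere. -/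
theorem HalfSphere.mem_vertical {ε : ℝ} (hε : ε ^ 2 = 1) (p : HalfSphere ε) {t : ℝ}
    (h0 : 0 ≤ t) (h1 : t ≤ 1) :
    let y := (1 - t) * √(16 - p.1.toComplex.re ^ 2) + t * (ε * p.1.toComplex.im)
    0 ≤ y ∧ (p.1.toComplex.re ^ 2 + (ε * y) ^ 2 ≤ 16 ∧
      1 / 4 ≤ (p.1.toComplex.re + 2) ^ 2 + (ε * y) ^ 2 ∧
        1 / 4 ≤ p.1.toComplex.re ^ 2 + (ε * y) ^ 2 ∧
          1 / 4 ≤ (p.1.toComplex.re - 2) ^ 2 + (ε * y) ^ 2) := by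
  intro y
  obtain ⟨m1, m2, m3, m4⟩ := p.1.mem
  have hp := p.2
  have hs : √(16 - p.1.toComplex.re ^ 2) ^ 2 = 16 - p.1.toComplex.re ^ 2 :=
    Real.sq_sqrt (by nlinarith)
  have hs0 := Real.sqrt_nonneg (16 - p.1.toComplex.re ^ 2)
  have him : (ε * p.1.toComplex.im) ^ 2 = p.1.toComplex.im ^ 2 := by rw [mul_pow, hε, one_mul]
  have hy2 : (ε * y) ^ 2 = y ^ 2 := by rw [mul_pow, hε, one_mul]
  have hle : ε * p.1.toComplex.im ≤ √(16 - p.1.toComplex.re ^ 2) :=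
    abs_le_of_sq_le_sq' (by rw [hs, him]; linarith) hs0 |>.2
  have hy1 : ε * p.1.toComplex.im ≤ y := by
    have := mul_nonneg (sub_nonneg.2 h1) (sub_nonneg.2 hle)
    simp only [y]; linarith
  have hy3 : y ≤ √(16 - p.1.toComplex.re ^ 2) := by
    have := mul_nonneg h0 (sub_nonneg.2 hle)
    simp only [y]; linarith
  have hy0 : 0 ≤ y := hp.trans hy1
  have hlow : p.1.toComplex.im ^ 2 ≤ y ^ 2 := by
    rw [← him]; exact pow_le_pow_left₀ hp hy1 2
  have hupp : y ^ 2 ≤ 16 - p.1.toComplex.re ^ 2 := by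
    rw [← hs]; exact pow_le_pow_left₀ hy0 hy3 2
  rw [hy2]
  refine ⟨hy0, ?_, ?_, ?_, ?_⟩ <;> linarith

/-- The vertical homotopy of a half sphere to its part of the outer boundary circle. -/
def HalfSphere.vertical {ε : ℝ} (hε : ε ^ 2 = 1) (t : I) (p : HalfSphere ε) : HalfSphere ε :=
  ⟨⟨⟨p.1.toComplex.re,
      ε * ((1 - t) * √(16 - p.1.toComplex.re ^ 2) + t * (ε * p.1.toComplex.im))⟩,
    (mem_fourHoledSphere_iff _).2 (p.mem_vertical hε t.2.1 t.2.2).2⟩, by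
      change 0 ≤ ε * (ε * _)
      rw [← mul_assoc, ← pow_two, hε, one_mul]
      exact (p.mem_vertical hε t.2.1 t.2.2).1⟩

theorem continuous_complexMk {X : Type*} [TopologicalSpace X] {a b : X → ℝ} (ha : Continuous a)
    (hb : Continuous b) : Continuous fun x => (⟨a x, b x⟩ : ℂ) :=
  Complex.equivRealProdCLM.symm.continuous.comp (ha.prodMk hb)

theorem HalfSphere.continuous_vertical {ε : ℝ} (hε : ε ^ 2 = 1) :
    Continuous fun x : I × HalfSphere ε => x.2.vertical hε x.1 := by
  refine continuous_toHalfSphere ?_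
  have := FourHoledSphere.continuous_toComplex
  exact continuous_complexMk (by fun_prop) (by fun_prop)

/-- The point of the outer boundary circle of a half sphere with given real part. -/
def HalfSphere.arc {ε : ℝ} (hε : ε ^ 2 = 1) (x : Set.Icc (-4 : ℝ) 4) : HalfSphere ε :=
  ⟨⟨⟨x, ε * √(16 - (x : ℝ) ^ 2)⟩, (mem_fourHoledSphere_iff _).2 (by
      obtain ⟨x, h1, h2⟩ := x
      have hs : (ε * √(16 - x ^ 2)) ^ 2 = 16 - x ^ 2 := by
        rw [mul_pow, hε, one_mul, Real.sq_sqrt (by nlinarith)]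
      simp only [hs]
      refine ⟨?_, ?_, ?_, ?_⟩ <;> nlinarith)⟩, by
    change 0 ≤ ε * (ε * _)
    rw [← mul_assoc, ← pow_two, hε, one_mul]
    exact Real.sqrt_nonneg _⟩

/-- Moving vertically away from the real axis never enters a hole, so the half deforms onto its
outer arc, which the real part identifies with an interval. -/
theorem simplyConnectedSpace_halfSphere {ε : ℝ} (hε : ε ^ 2 = 1) :
    SimplyConnectedSpace (HalfSphere ε) := by
  have : ContractibleSpace (Set.Icc (-4 : ℝ) 4) :=
    (convex_Icc _ _).contractibleSpace ⟨0, by norm_num⟩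
  have hc := FourHoledSphere.continuous_toComplex
  let toI : C(HalfSphere ε, Set.Icc (-4 : ℝ) 4) :=
    ⟨fun p => ⟨p.1.toComplex.re, by
      have := p.1.mem.1
      constructor <;> nlinarith [sq_nonneg p.1.toComplex.im]⟩, by fun_prop⟩
  let ofI : C(Set.Icc (-4 : ℝ) 4, HalfSphere ε) := ⟨HalfSphere.arc hε,
    continuous_toHalfSphere (continuous_complexMk (by fun_prop) (by fun_prop))⟩
  let e : ContinuousMap.HomotopyEquiv (HalfSphere ε) (Set.Icc (-4 : ℝ) 4) :=
    { toFun := toI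
      invFun := ofI
      left_inv := ⟨
        { toFun := fun x => x.2.vertical hε x.1
          continuous_toFun := HalfSphere.continuous_vertical hε
          map_zero_left := fun p => by
            refine Subtype.ext (Subtype.ext (Complex.ext rfl ?_))
            change ε * ((1 - 0) * √(16 - p.1.toComplex.re ^ 2) + 0 * (ε * p.1.toComplex.im)) =
              ε * √(16 - p.1.toComplex.re ^ 2)
            ring
          map_one_left := fun p => by
            refine Subtype.ext (Subtype.ext (Complex.ext rfl ?_))
            change ε * ((1 - 1) * √(16 - p.1.toComplex.re ^ 2) + 1 * (ε * p.1.toComplex.im)) =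
              p.1.toComplex.im
            linear_combination p.1.toComplex.im * hε }⟩
      right_inv := by
        have : toI.comp ofI = .id _ := rfl
        rw [this] }
  exact e.simplyConnectedSpace

theorem homotopic_of_forall_im {ε : ℝ} (hε : ε ^ 2 = 1) {a b : FourHoledSphere} {p q : Path a b}
    (hp : ∀ t, 0 ≤ ε * (p t).toComplex.im) (hq : ∀ t, 0 ≤ ε * (q t).toComplex.im) :
    p.Homotopic q := by
  have := simplyConnectedSpace_halfSphere hε
  have ha : 0 ≤ ε * a.toComplex.im := by simpa using hp 0
  have hb : 0 ≤ ε * b.toComplex.im := by simpa using hp 1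
  let lift : ∀ r : Path a b, (∀ t, 0 ≤ ε * (r t).toComplex.im) →
      Path (⟨a, ha⟩ : HalfSphere ε) ⟨b, hb⟩ := fun r hr =>
    { toFun := fun t => ⟨r t, hr t⟩
      continuous_toFun := r.continuous.subtype_mk _
      source' := Subtype.ext r.source
      target' := Subtype.ext r.target }
  exact (SimplyConnectedSpace.paths_homotopic (lift p hp) (lift q hq)).map
    ⟨Subtype.val, continuous_subtype_val⟩

theorem exists_real_path (a b : FourHoledSphere) (ha : a.toComplex.im = 0)
    (hb : b.toComplex.im = 0)
    (h : ∀ r : ℝ, b.toComplex.re ≤ r → r ≤ a.toComplex.re →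
      r ^ 2 ≤ 16 ∧ 1 / 4 ≤ (r + 2) ^ 2 ∧ 1 / 4 ≤ r ^ 2 ∧ 1 / 4 ≤ (r - 2) ^ 2)
    (hab : b.toComplex.re ≤ a.toComplex.re) :
    ∃ p : Path a b, ∀ t, (p t).toComplex.im = 0 := by
  have hmem : ∀ t : I, _ := fun t : I =>
    (mem_fourHoledSphere_iff
      ⟨a.toComplex.re + t * (b.toComplex.re - a.toComplex.re), 0⟩).2 (by
        have := h (a.toComplex.re + t * (b.toComplex.re - a.toComplex.re))
          (by nlinarith [t.2.1, t.2.2]) (by nlinarith [t.2.1, t.2.2])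
        simpa using this)
  refine ⟨{ toFun := fun t => ⟨_, hmem t⟩
            continuous_toFun := (continuous_complexMk (by fun_prop) (by fun_prop)).subtype_mk _
            source' := Subtype.ext (Complex.ext ?_ ?_)
            target' := Subtype.ext (Complex.ext ?_ ?_) }, fun t => rfl⟩
  · change _ + 0 * _ = a.toComplex.re; ring
  · exact ha.symm
  · change _ + 1 * _ = b.toComplex.re; ring
  · exact hb.symm

/-! ## Congruence modulo a subgroup of a vertex group -/

/-- Two arrows of a groupoid are congruent modulo a subgroup `N` of the vertex group at `x` if
the loops at `x` that follow one and return along the other are in `N`. -/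
def CongrMod {C : Type*} [Groupoid C] {x : C} (N : Subgroup (End x)) {p q : C} (a b : p ⟶ q) :
    Prop :=
  ∀ c : x ⟶ p, End.of (c ≫ a ≫ Groupoid.inv b ≫ Groupoid.inv c) ∈ N

section CongrMod

variable {C : Type*} [Groupoid C] {x : C} {N : Subgroup (End x)} {p q r : C}

theorem CongrMod.refl (a : p ⟶ q) : CongrMod N a a := fun c => by
  have : End.of (c ≫ a ≫ Groupoid.inv a ≫ Groupoid.inv c) = 1 := by
    change c ≫ a ≫ Groupoid.inv a ≫ Groupoid.inv c = 𝟙 x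
    simp [Groupoid.inv_eq_inv]
  rw [this]
  exact N.one_mem

theorem CongrMod.symm {a b : p ⟶ q} (h : CongrMod N a b) : CongrMod N b a := fun c => by
  have : End.of (c ≫ b ≫ Groupoid.inv a ≫ Groupoid.inv c) =
      (End.of (c ≫ a ≫ Groupoid.inv b ≫ Groupoid.inv c))⁻¹ := by
    refine eq_inv_of_mul_eq_one_left ?_
    change (c ≫ a ≫ Groupoid.inv b ≫ Groupoid.inv c) ≫ c ≫ b ≫ Groupoid.inv a ≫ Groupoid.inv c = 𝟙 x
    simp [Groupoid.inv_eq_inv]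
  rw [this]
  exact N.inv_mem (h c)

/-- As `CongrMod` quantifies over all approach paths, `a` can be absorbed into the approach `c`;
normality of `N` is not needed. -/
theorem CongrMod.comp {a b : p ⟶ q} {a' b' : q ⟶ r} (h : CongrMod N a b) (h' : CongrMod N a' b') :
    CongrMod N (a ≫ a') (b ≫ b') := fun c => by
  have : End.of (c ≫ (a ≫ a') ≫ Groupoid.inv (b ≫ b') ≫ Groupoid.inv c) =
      End.of (c ≫ a ≫ Groupoid.inv b ≫ Groupoid.inv c) *
        End.of ((c ≫ a) ≫ a' ≫ Groupoid.inv b' ≫ Groupoid.inv (c ≫ a)) := by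
    change _ = ((c ≫ a) ≫ a' ≫ Groupoid.inv b' ≫ Groupoid.inv (c ≫ a)) ≫
      c ≫ a ≫ Groupoid.inv b ≫ Groupoid.inv c
    simp [Groupoid.inv_eq_inv]
  rw [this]
  exact N.mul_mem (h c) (h' (c ≫ a))

/-- If `a b⁻¹` is freely conjugate to the loop `l`, then `a` and `b` are congruent modulo `N` iff
every conjugate of `l` at `x` is in `N`. -/
theorem congrMod_iff_of_comp_eq {a b : p ⟶ q} (η : p ⟶ r) (l : r ⟶ r)
    (h : (a ≫ Groupoid.inv b) ≫ η = η ≫ l) :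
    CongrMod N a b ↔ ∀ c : x ⟶ r, End.of (c ≫ l ≫ Groupoid.inv c) ∈ N := by
  have key : l = Groupoid.inv η ≫ a ≫ Groupoid.inv b ≫ η := by
    rw [← Category.assoc a, h]; simp [Groupoid.inv_eq_inv]
  subst key
  constructor
  · intro H c
    have := H (c ≫ Groupoid.inv η)
    simpa [Groupoid.inv_eq_inv] using this
  · intro H c
    have := H (c ≫ η)
    simpa [Groupoid.inv_eq_inv] using this

theorem forall_conj_mem_of_mem [N.Normal] (d : x ⟶ r) (l : r ⟶ r)
    (h : End.of (d ≫ l ≫ Groupoid.inv d) ∈ N) (c : x ⟶ r) :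
    End.of (c ≫ l ≫ Groupoid.inv c) ∈ N := by
  have := Subgroup.Normal.conj_mem ‹_› _ h (End.of (d ≫ Groupoid.inv c))
  convert this using 1
  have hi : (End.of (d ≫ Groupoid.inv c))⁻¹ = End.of (c ≫ Groupoid.inv d) := by
    refine (eq_inv_of_mul_eq_one_left ?_).symm
    change (d ≫ Groupoid.inv c) ≫ c ≫ Groupoid.inv d = 𝟙 x
    simp [Groupoid.inv_eq_inv]
  rw [hi]
  change _ = (c ≫ Groupoid.inv d) ≫ (d ≫ l ≫ Groupoid.inv d) ≫ d ≫ Groupoid.inv c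
  simp [Groupoid.inv_eq_inv]

end CongrMod

/-! ## Half circles -/

/-- The path along the upper half circle from `1` to `-1`. -/
def upperHalf : Path (1 : Circle) (Circle.exp Real.pi) where
  toFun t := Circle.exp (Real.pi * (t : ℝ))
  source' := by simp
  target' := by simp

/-- The path along the lower half circle from `1` to `-1`. -/
def lowerHalf : Path (1 : Circle) (Circle.exp Real.pi) where
  toFun t := Circle.exp (-Real.pi * (t : ℝ))
  source' := by simp
  target' := by ext; simp

/-- The loop that runs once around the circle. -/
def fullCircle : Path (1 : Circle) 1 where
  toFun t := Circle.exp (2 * Real.pi * (t : ℝ))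
  source' := by simp
  target' := by simp

/-- Both loops lift to paths from `0` to `2π` in the simply connected line; the reversed lower half
lifts after a shift by `2π`. -/
theorem homotopic_fullCircle : (upperHalf.trans lowerHalf.symm).Homotopic fullCircle := by
  let p1 : Path (0 : ℝ) Real.pi := ⟨⟨fun t => Real.pi * (t : ℝ), by fun_prop⟩, by simp, by simp⟩
  let p2 : Path Real.pi (2 * Real.pi) :=
    ⟨⟨fun t => Real.pi + Real.pi * (t : ℝ), by fun_prop⟩, by simp, by simp; ring⟩
  let p3 : Path (0 : ℝ) (2 * Real.pi) :=
    ⟨⟨fun t => 2 * Real.pi * (t : ℝ), by fun_prop⟩, by simp, by simp⟩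
  have h := (SimplyConnectedSpace.paths_homotopic (p1.trans p2) p3).map Circle.exp
  have h0 : (1 : Circle) = Circle.exp 0 := by simp
  have h1 : (1 : Circle) = Circle.exp (2 * Real.pi) := by simp
  have h' := h.pathCast h0 h1
  have e3 : (p3.map Circle.exp.continuous).cast h0 h1 = fullCircle := by ext t; rfl
  have e12 : ((p1.trans p2).map Circle.exp.continuous).cast h0 h1 =
      upperHalf.trans lowerHalf.symm := by
    rw [Path.map_trans]
    ext t
    simp only [Path.cast_coe, Path.trans_apply]
    split_ifs with ht
    · rfl
    · change ((Circle.exp (Real.pi + Real.pi * (2 * t - 1)) : Circle) : ℂ) =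
        Circle.exp (-Real.pi * (1 - (2 * t - 1)))
      rw [show Real.pi + Real.pi * (2 * (t : ℝ) - 1) =
        -Real.pi * (1 - (2 * t - 1)) + 2 * Real.pi by ring, Circle.exp_add, Circle.exp_two_pi,
        mul_one]
  rw [← e3, ← e12]
  exact h'

/-! ## The boundary circles in `𝕌` -/

/-- The `i`-th boundary circle, as a continuous map. -/
def boundaryMap (i : Fin 4) : C(Circle, FourHoledSphere) :=
  ⟨boundaryCircle i, continuous_boundaryCircle i⟩

/-- The inclusion of `Σ_s` in `𝕌`. -/
def surfaceMap (s : Label) : C(FourHoledSphere, U) where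
  toFun p := Quot.mk Glue (Pieces.surf s p)
  continuous_toFun := continuous_quot_mk.comp
    (continuous_inl.comp (continuous_inr.comp continuous_sigmaMk))

/-- The inclusion of the vertex circle `s` in `𝕌`. -/
def circleMap (s : Label) : C(Circle, U) := ⟨circlePoint s, continuous_circlePoint s⟩

/-- The homotopy along the cylinder over the edge `(s, i)`. -/
def cylinderHomotopy (s : Label) (i : Fin 4) :
    ContinuousMap.Homotopy ((surfaceMap s).comp (boundaryMap i)) (circleMap (target s i)) where
  toFun x := Quot.mk Glue (Pieces.cyl s i x.1 x.2)
  continuous_toFun := continuous_quot_mk.comp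
    (continuous_inr.comp
      (@continuous_sigmaMk (Label × Fin 4) (fun _ => I × Circle) _ (s, i)))
  map_zero_left z := Quot.sound (Glue.surf s i z)
  map_one_left z := Quot.sound (Glue.circ s i z)

/-- The arrow of the fundamental groupoid given by a path. -/
abbrev pathArrow {X : Type*} [TopologicalSpace X] {a b : X} (p : Path a b) :
    FundamentalGroupoid.mk a ⟶ FundamentalGroupoid.mk b :=
  Path.Homotopic.Quotient.mk p

theorem pathArrow_trans {X : Type*} [TopologicalSpace X] {a b c : X} (p : Path a b)
    (q : Path b c) : pathArrow (p.trans q) = pathArrow p ≫ pathArrow q := rfl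

theorem pathArrow_eq {X : Type*} [TopologicalSpace X] {a b : X} {p q : Path a b}
    (h : p.Homotopic q) : pathArrow p = pathArrow q :=
  Path.Homotopic.Quotient.eq.2 h

/-- The image in `𝕌` of a path in `Σ_s`. -/
abbrev surfaceArrow (s : Label) {a b : FourHoledSphere} (p : Path a b) :
    FundamentalGroupoid.mk (surfaceMap s a) ⟶ FundamentalGroupoid.mk (surfaceMap s b) :=
  pathArrow (p.map (surfaceMap s).continuous)

theorem surfaceArrow_trans (s : Label) {a b c : FourHoledSphere} (p : Path a b) (q : Path b c) :
    surfaceArrow s (p.trans q) = surfaceArrow s p ≫ surfaceArrow s q := by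
  rw [← pathArrow_trans, ← Path.map_trans]

theorem surfaceArrow_eq (s : Label) {a b : FourHoledSphere} {p q : Path a b}
    (h : p.Homotopic q) : surfaceArrow s p = surfaceArrow s q :=
  pathArrow_eq (h.map (surfaceMap s))

/-! ### Outer and inner boundary circles modulo a subgroup -/

/-- The upper half of the `i`-th boundary circle, in the chosen parametrization. -/
abbrev boundaryUpper (i : Fin 4) :
    Path (boundaryCircle i 1) (boundaryCircle i (Circle.exp Real.pi)) :=
  upperHalf.map (boundaryMap i).continuous

/-- The lower half of the `i`-th boundary circle, in the chosen parametrization. -/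
abbrev boundaryLower (i : Fin 4) :
    Path (boundaryCircle i 1) (boundaryCircle i (Circle.exp Real.pi)) :=
  lowerHalf.map (boundaryMap i).continuous

/-- The upper half followed by the reversed lower half is the boundary loop, and the cylinder
carries it freely to the vertex circle. One direction serves the inner circles, the other the outer
one. -/
theorem congrMod_boundary_iff {x : U} {N : Subgroup (FundamentalGroup U x)} (s : Label)
    (i : Fin 4) :
    CongrMod N (surfaceArrow s (boundaryUpper i)) (surfaceArrow s (boundaryLower i)) ↔
      ∀ c : FundamentalGroupoid.mk x ⟶ FundamentalGroupoid.mk (circlePoint (target s i) 1),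
        End.of (c ≫ pathArrow (circleLoop (target s i)) ≫ Groupoid.inv c) ∈ N := by
  refine congrMod_iff_of_comp_eq (pathArrow ((cylinderHomotopy s i).evalAt 1)) _ ?_
  have h1 := pathArrow_eq (homotopic_fullCircle.map ((surfaceMap s).comp (boundaryMap i)))
  have h2 := pathArrow_eq (Path.Homotopic.map_trans_evalAt (cylinderHomotopy s i) fullCircle)
  rw [Path.map_trans, pathArrow_trans] at h1
  rw [pathArrow_trans, pathArrow_trans] at h2
  exact (congrArg (· ≫ _) h1).trans h2

theorem im_boundaryCircle_exp (i : Fin 4) (r : ℝ) :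
    (boundaryCircle i (Circle.exp r)).toComplex.im =
      (match i with
        | 0 => 4
        | 1 => -1 / 2
        | 2 => -1 / 2
        | 3 => 1 / 2) * Real.sin r := by
  change (boundaryPoint i (Circle.exp r)).im = _
  match i with
  | 0 => simp [boundaryPoint]
  | 1 => simp [boundaryPoint]; ring
  | 2 => simp [boundaryPoint]; ring
  | 3 => simp [boundaryPoint]; ring

theorem toComplex_boundaryCircle_one (i : Fin 4) :
    (boundaryCircle i 1).toComplex = ((match i with
        | 0 => 4
        | 1 => -3 / 2
        | 2 => 1 / 2
        | 3 => 5 / 2 : ℝ) : ℂ) := by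
  change boundaryPoint i 1 = _
  match i with
  | 0 => simp [boundaryPoint]
  | 1 => simp [boundaryPoint]; norm_num
  | 2 => simp [boundaryPoint]
  | 3 => simp [boundaryPoint]; norm_num

theorem toComplex_boundaryCircle_exp_pi (i : Fin 4) :
    (boundaryCircle i (Circle.exp Real.pi)).toComplex = ((match i with
        | 0 => -4
        | 1 => -5 / 2
        | 2 => -1 / 2
        | 3 => 3 / 2 : ℝ) : ℂ) := by
  have h : ((Circle.exp Real.pi : Circle) : ℂ) = -1 := by
    rw [Circle.coe_exp, Complex.exp_pi_mul_I]
  change boundaryPoint i (Circle.exp Real.pi) = _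
  match i with
  | 0 => simp [boundaryPoint, h]
  | 1 => simp [boundaryPoint, h]; norm_num
  | 2 => simp [boundaryPoint, h]
  | 3 => simp [boundaryPoint, h]; norm_num

theorem nonneg_im_trans {ε : ℝ} {a b c : FourHoledSphere} {p : Path a b} {q : Path b c}
    (hp : ∀ t, 0 ≤ ε * (p t).toComplex.im) (hq : ∀ t, 0 ≤ ε * (q t).toComplex.im) (t : I) :
    0 ≤ ε * (p.trans q t).toComplex.im := by
  rw [Path.trans_apply]
  split_ifs
  · exact hp _
  · exact hq _

theorem sin_pi_mul_nonneg (t : I) : 0 ≤ Real.sin (Real.pi * t) :=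
  Real.sin_nonneg_of_nonneg_of_le_pi (mul_nonneg Real.pi_pos.le t.2.1)
    (mul_le_of_le_one_right Real.pi_pos.le t.2.2)

theorem im_boundaryUpper (i : Fin 4) (t : I) :
    (boundaryUpper i t).toComplex.im = (match i with
        | 0 => 4
        | 1 => -1 / 2
        | 2 => -1 / 2
        | 3 => 1 / 2) * Real.sin (Real.pi * t) :=
  im_boundaryCircle_exp i _

theorem im_boundaryLower (i : Fin 4) (t : I) :
    (boundaryLower i t).toComplex.im = -((match i with
        | 0 => 4
        | 1 => -1 / 2
        | 2 => -1 / 2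
        | 3 => 1 / 2) * Real.sin (Real.pi * t)) := by
  refine (im_boundaryCircle_exp i _).trans ?_
  rw [neg_mul, Real.sin_neg, mul_neg]

theorem congrMod_outer_of_inner {x : U} {N : Subgroup (FundamentalGroup U x)} (s : Label)
    (h : ∀ i ≠ 0, CongrMod N (surfaceArrow s (boundaryUpper i))
      (surfaceArrow s (boundaryLower i))) :
    CongrMod N (surfaceArrow s (boundaryUpper 0)) (surfaceArrow s (boundaryLower 0)) := by
  -- The four intervals of the real axis outside the holes, from right to left: `[5/2, 4]`, `[1/2,
  -- 3/2]`, `[-3/2, -1/2]`, `[-4, -5/2]`.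
  obtain ⟨p₀, h₀⟩ := exists_real_path (boundaryCircle 0 1) (boundaryCircle 3 1)
    (by simp [toComplex_boundaryCircle_one]) (by simp [toComplex_boundaryCircle_one])
    (by
      simp only [toComplex_boundaryCircle_one, Complex.ofReal_re]
      intro r h1 h2; refine ⟨?_, ?_, ?_, ?_⟩ <;> nlinarith)
    (by simp only [toComplex_boundaryCircle_one, Complex.ofReal_re]; norm_num)
  obtain ⟨p₁, h₁⟩ := exists_real_path (boundaryCircle 3 (Circle.exp Real.pi)) (boundaryCircle 2 1)
    (by simp [toComplex_boundaryCircle_exp_pi]) (by simp [toComplex_boundaryCircle_one])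
    (by
      simp only [toComplex_boundaryCircle_one, toComplex_boundaryCircle_exp_pi, Complex.ofReal_re]
      intro r h1 h2; refine ⟨?_, ?_, ?_, ?_⟩ <;> nlinarith)
    (by
      simp only [toComplex_boundaryCircle_one, toComplex_boundaryCircle_exp_pi, Complex.ofReal_re]
      norm_num)
  obtain ⟨p₂, h₂⟩ := exists_real_path (boundaryCircle 2 (Circle.exp Real.pi)) (boundaryCircle 1 1)
    (by simp [toComplex_boundaryCircle_exp_pi]) (by simp [toComplex_boundaryCircle_one])
    (by
      simp only [toComplex_boundaryCircle_one, toComplex_boundaryCircle_exp_pi, Complex.ofReal_re]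
      intro r h1 h2; refine ⟨?_, ?_, ?_, ?_⟩ <;> nlinarith)
    (by
      simp only [toComplex_boundaryCircle_one, toComplex_boundaryCircle_exp_pi, Complex.ofReal_re]
      norm_num)
  obtain ⟨p₃, h₃⟩ := exists_real_path (boundaryCircle 1 (Circle.exp Real.pi))
    (boundaryCircle 0 (Circle.exp Real.pi))
    (by simp [toComplex_boundaryCircle_exp_pi]) (by simp [toComplex_boundaryCircle_exp_pi])
    (by
      simp only [toComplex_boundaryCircle_exp_pi, Complex.ofReal_re]
      intro r h1 h2; refine ⟨?_, ?_, ?_, ?_⟩ <;> nlinarith)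
    (by simp only [toComplex_boundaryCircle_exp_pi, Complex.ofReal_re]; norm_num)
  have hp : ∀ {ε : ℝ} {a b : FourHoledSphere} {p : Path a b}, (∀ t, (p t).toComplex.im = 0) →
      ∀ t, 0 ≤ ε * (p t).toComplex.im := fun h t => by rw [h t, mul_zero]
  -- Circles `1` and `2` are parametrized clockwise, so their `boundaryLower` lies in the upper half
  -- plane; hence the uses of `symm` at the end.
  have upper : surfaceArrow s (boundaryUpper 0) = surfaceArrow s (p₀.trans ((boundaryUpper 3).trans
      (p₁.trans ((boundaryLower 2).trans (p₂.trans ((boundaryLower 1).trans p₃)))))) := by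
    refine surfaceArrow_eq s (homotopic_of_forall_im (ε := 1) (by norm_num) (fun t => ?_)
      (nonneg_im_trans (hp h₀) (nonneg_im_trans (fun t => ?_) (nonneg_im_trans (hp h₁)
        (nonneg_im_trans (fun t => ?_) (nonneg_im_trans (hp h₂)
          (nonneg_im_trans (fun t => ?_) (hp h₃))))))))
    all_goals
      have := sin_pi_mul_nonneg t
      first
        | rw [im_boundaryUpper]
        | rw [im_boundaryLower]
      dsimp only
      linarith
  have lower : surfaceArrow s (boundaryLower 0) = surfaceArrow s (p₀.trans ((boundaryLower 3).trans
      (p₁.trans ((boundaryUpper 2).trans (p₂.trans ((boundaryUpper 1).trans p₃)))))) := by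
    refine surfaceArrow_eq s (homotopic_of_forall_im (ε := -1) (by norm_num) (fun t => ?_)
      (nonneg_im_trans (hp h₀) (nonneg_im_trans (fun t => ?_) (nonneg_im_trans (hp h₁)
        (nonneg_im_trans (fun t => ?_) (nonneg_im_trans (hp h₂)
          (nonneg_im_trans (fun t => ?_) (hp h₃))))))))
    all_goals
      have := sin_pi_mul_nonneg t
      first
        | rw [im_boundaryUpper]
        | rw [im_boundaryLower]
      dsimp only
      linarith
  rw [upper, lower]
  simp only [surfaceArrow_trans]
  exact (CongrMod.refl _).comp ((h 3 (by decide)).comp ((CongrMod.refl _).comp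
    ((h 2 (by decide)).symm.comp ((CongrMod.refl _).comp
      ((h 1 (by decide)).symm.comp (CongrMod.refl _))))))

theorem normalClosure_loopElement_le (s : Label) {x : U} (γ : Path x (circlePoint s 1))
    (γ' : Path x (circlePoint s.other 1)) :
    Subgroup.normalClosure {loopElement s γ} ≤ Subgroup.normalClosure {loopElement s.other γ'} := by
  have target_other : ∀ i ≠ 0, target s i = s.other := fun i hi => if_neg hi
  have hconj : ∀ c, End.of (c ≫ pathArrow (circleLoop s.other) ≫ Groupoid.inv c) ∈
      Subgroup.normalClosure {loopElement s.other γ'} := by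
    refine forall_conj_mem_of_mem (pathArrow γ') _ ?_
    rw [← Category.assoc]
    exact Subgroup.subset_normalClosure rfl
  have hin : ∀ i ≠ 0, CongrMod (Subgroup.normalClosure {loopElement s.other γ'})
      (surfaceArrow s (boundaryUpper i)) (surfaceArrow s (boundaryLower i)) := fun i hi => by
    rw [congrMod_boundary_iff, target_other i hi]
    exact hconj
  have hout := (congrMod_boundary_iff s 0).1 (congrMod_outer_of_inner s hin) (pathArrow γ)
  refine Subgroup.normalClosure_le_normal (Set.singleton_subset_iff.2 ?_)
  rw [← Category.assoc] at hout
  exact hout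

end MagnusPair

end

theorem mainTheorem9 (x : MagnusPair.U)
    (γu : Path x (MagnusPair.circlePoint MagnusPair.Label.u 1))
    (γv : Path x (MagnusPair.circlePoint MagnusPair.Label.v 1)) :
    MagnusPair.IsMagnusPair
      (MagnusPair.loopElement MagnusPair.Label.u γu)
      (MagnusPair.loopElement MagnusPair.Label.v γv) :=
  ⟨MagnusPair.pmClass_loopElement_ne γu γv,
    le_antisymm (MagnusPair.normalClosure_loopElement_le .u γu γv)
      (MagnusPair.normalClosure_loopElement_le .v γv γu)⟩
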